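/- Let $X\subseteq\mathbb R^m$ and $Y\subseteq\mathbb R^n$ be open and bounded, with $0\in\bar Y$, and let $c:\bar X\times\bar Y\to\mathbb R$ be continuous and Lipschitz in its second variable, uniformly in the first; put $$M_c:=\sup\Big\{\frac{|c(x,y_0)-c(x,y_1)|}{|y_0-y_1|}\;:\;x\in\bar X,\ y_0,y_1\in\bar Y,\ y_0\ne y_1\Big\}<\infty$$ (this holds for instance if $c$ is the restriction of a $C^2$ function defined near $\bar X\times\bar Y$). Let $f:[0,\infty)\to\mathbb R$ be strictly convex, continuously differentiable on $(0,\infty)$, with $f(t)/t\to\infty$ as $t\to\infty$ and $f'(t)\to-\infty$ as $t\to0^+$, so that $f':(0,\infty)\to\mathbb R$ is a bijection with inverse $(f')^{-1}:\mathbb R\to(0,\infty)$. For a bounded measurable $v:Y\to\mathbb R$ let $K_v:(0,\infty)\to\mathbb R$ be the inverse of the increasing bijection $z\mapsto\int_Y(f')^{-1}(z-v(y))\,dy$ from $\mathbb R$ onto $(0,\infty)$; $K_{\pm M_c|y|}$ denotes $K_v$ for $v(y)=\pm M_c|y|$. For probability measures $\mu$ on $\bar X$ and $\nu$ on $\bar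 Y$ let $\mathcal T_c(\mu,\nu)=\inf_{\gamma}\int c\,d\gamma$, the infimum being over all probability measures $\gamma$ on $\bar X\times\bar Y$ with marginals $\mu$ and $\nu$. Let $\mathcal F(\nu)=\int_Y f(\bar\nu(y))\,dy\in(-\infty,+\infty]$ if $\nu$ is absolutely continuous with respect to Lebesgue measure on $Y$, with density $\bar\nu$, and $\mathcal F(\nu)=+\infty$ otherwise. Fix a probability measure $\mu$ on $\bar X$ and let $\nu$ be any minimizer of $\nu\mapsto\mathcal T_c(\mu,\nu)+\mathcal F(\nu)$ over the probability measures on $\bar Y$. Then $\nu$ is absolutely continuous with respect to Lebesgue measure on $Y$, and for Lebesgue-almost every $y\in Y$ its density satisfies $$(f')^{-1}\big(K_{-M_c|y|}(1)-M_c|y|\big)\;\le\;\bar\nu(y)\;\le\;(f')^{-1}\big(K_{M_c|y|}(1)+M_c|y|\big).$$ -/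

import Mathlib

open MeasureTheory Set Filter Topology

noncomputable section

namespace CongestionOT

/-- `ℝ^k` with the Euclidean norm. -/
abbrev E (k : ℕ) : Type := EuclideanSpace ℝ (Fin k)

/-- `P(S)`: the Borel probability measures on `ℝ^k` that are carried by the set `S`. -/
def probOn {k : ℕ} (S : Set (E k)) : Set (Measure (E k)) :=
  {ρ | IsProbabilityMeasure ρ ∧ ρ Sᶜ = 0}

/-- `Π(μ, ν)`: the measures on the product with marginals `μ` and `ν`. -/
def couplings {m n : ℕ} (μ : Measure (E m)) (ν : Measure (E n)) : Set (Measure (E m × E n)) :=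
  {γ | γ.map Prod.fst = μ ∧ γ.map Prod.snd = ν}

/-- The optimal transport cost `T_c(μ, ν)`, the infimum of `∫ c dγ` over `γ ∈ Π(μ, ν)`. It is used
for `c` continuous on a compact set that carries all couplings, where each integral converges and
the infimum is that of a nonempty set that is bounded below. -/
def transportCost {m n : ℕ} (c : E m → E n → ℝ) (μ : Measure (E m)) (ν : Measure (E n)) : ℝ :=
  sInf ((fun γ : Measure (E m × E n) => ∫ p, c p.1 p.2 ∂γ) '' couplings μ ν)

/-- Congestion functions: `f : [0, ∞) → ℝ` is strictly convex, continuously differentiable on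
`(0, ∞)`, superlinear at infinity, and `f'(t) → -∞` as `t → 0⁺`. Values of `f` at negative
arguments play no role. -/
structure IsCongestionFunction (f : ℝ → ℝ) : Prop where
  contDiffOn : ContDiffOn ℝ 1 f (Ioi 0)
  strictConvexOn : StrictConvexOn ℝ (Ici 0) f
  superlinear : Tendsto (fun t => f t / t) atTop atTop
  deriv_zero : Tendsto (deriv f) (𝓝[>] 0) atBot

/-- The Lebesgue density of `ν`. -/
def density {n : ℕ} (ν : Measure (E n)) (y : E n) : ℝ :=
  (ν.rnDeriv volume y).toReal

open Classical in
/-- The congestion functional `F(ν) = ∫_Y f(ν̄(y)) dy`, with `F(ν) = +∞` when `ν` is not absolutely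
continuous with respect to Lebesgue measure on `Y`. For a congestion function and bounded `Y` the
negative part of `f(ν̄)` is integrable over `Y`, so where `f(ν̄)` is not integrable the integral
is `+∞`. -/
def congestion {n : ℕ} (Y : Set (E n)) (f : ℝ → ℝ) (ν : Measure (E n)) : EReal :=
  if ν ≪ volume.restrict Y ∧ IntegrableOn (fun y => f (density ν y)) Y then
    ((∫ y in Y, f (density ν y) : ℝ) : EReal)
  else ⊤

/-- The functional `ν ↦ T_c(μ, ν) + F(ν)`. -/
def energy {m n : ℕ} (Y : Set (E n)) (c : E m → E n → ℝ) (f : ℝ → ℝ) (μ : Measure (E m))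
    (ν : Measure (E n)) : EReal :=
  (transportCost c μ ν : EReal) + congestion Y f ν

/-- `ν` minimizes `T_c(μ, ·) + F` over the probability measures on the closure of `Y`. -/
def IsMinimizer {m n : ℕ} (Y : Set (E n)) (c : E m → E n → ℝ) (f : ℝ → ℝ) (μ : Measure (E m))
    (ν : Measure (E n)) : Prop :=
  ν ∈ probOn (closure Y) ∧ IsMinOn (energy Y c f μ) (probOn (closure Y)) ν

/-- The difference quotients of `c` in the variable `y`, over the closures of `X` and `Y`. The
Euclidean distance of `(x, y₀)` and `(x, y₁)` is `‖y₀ - y₁‖`. -/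
def lipQuotients {m n : ℕ} (X : Set (E m)) (Y : Set (E n)) (c : E m → E n → ℝ) : Set ℝ :=
  {q | ∃ x ∈ closure X, ∃ y₀ ∈ closure Y, ∃ y₁ ∈ closure Y, y₀ ≠ y₁ ∧
    q = |c x y₀ - c x y₁| / ‖y₀ - y₁‖}

/-- `M_c`, the Lipschitz constant of `c` in the variable `y`. -/
def lipConst {m n : ℕ} (X : Set (E m)) (Y : Set (E n)) (c : E m → E n → ℝ) : ℝ :=
  sSup (lipQuotients X Y c)

/-- `(f')⁻¹ : ℝ → (0, ∞)`, the inverse of `f' : (0, ∞) → ℝ` (a bijection for a congestion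
function `f`). -/
def derivInv (f : ℝ → ℝ) : ℝ → ℝ :=
  Function.invFunOn (deriv f) (Ioi 0)

/-- `K_v : (0, ∞) → ℝ`, the inverse of the increasing bijection
`z ↦ ∫_Y (f')⁻¹(z - v(y)) dy` from `ℝ` onto `(0, ∞)`. -/
def K {n : ℕ} (Y : Set (E n)) (f : ℝ → ℝ) (v : E n → ℝ) : ℝ → ℝ :=
  Function.invFun (fun z : ℝ => ∫ y in Y, derivInv f (z - v y))

end CongestionOT

end

/-! The proof is a perturbation argument; no dual potentials or optimal plans occur. The uniform
distribution has finite energy, so a minimizer is absolutely continuous. Suppose its density exceeds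
`s` on `A` and stays below `s'` on `B`, and that going from `A` to `B` costs at most `L`. Moving a
small fraction `t` of the mass of `A` to `B` changes the energy, to first order, by at most `t *
ν(A) * (L + f'(s') - f'(s))`. Minimality forbids a negative value when both sets have positive
volume (`IsMinimizer.null_or_null`).

Localizing `A` and `B` near two points gives `L` close to `M_c` times their distance. Hence `f'` of
the density is `M_c`-Lipschitz off a null set (`IsMinimizer.exists_null_deriv_le`). Since `f' → -∞`
at zero, the density is also positive there. It therefore equals `(f')⁻¹(g)` for a globally
`M_c`-Lipschitz `g` (`IsMinimizer.exists_lipschitz`).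

Finally `g` lies between the cones `g(0) ± M_c|y|`, and the unit mass of `(f')⁻¹(g)` pins `g(0)`
between the two values of `K` (`mem_Icc_K_one_of_lipschitz`). -/

namespace CongestionOT

/-! ### Convexity of `f` and the inverse of `f'`. -/

section CongestionFunction

variable {f : ℝ → ℝ}

lemma IsCongestionFunction.hasDerivAt (hf : IsCongestionFunction f) {x : ℝ} (hx : 0 < x) :
    HasDerivAt f (deriv f x) x :=
  ((hf.contDiffOn.differentiableOn one_ne_zero).differentiableAt (Ioi_mem_nhds hx)).hasDerivAt

lemma IsCongestionFunction.strictMonoOn_deriv (hf : IsCongestionFunction f) :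
    StrictMonoOn (deriv f) (Ioi 0) :=
  (hf.strictConvexOn.subset Ioi_subset_Ici_self (convex_Ioi 0)).strictMonoOn_deriv
    fun _ hx => (hf.hasDerivAt hx).differentiableAt

lemma IsCongestionFunction.continuousOn_deriv (hf : IsCongestionFunction f) :
    ContinuousOn (deriv f) (Ioi 0) :=
  hf.contDiffOn.continuousOn_deriv_of_isOpen isOpen_Ioi le_rfl

/-- A congestion function lies above its tangents. -/
lemma IsCongestionFunction.tangent_le (hf : IsCongestionFunction f) {a b : ℝ} (ha : 0 ≤ a)
    (hb : 0 < b) : f b + deriv f b * (a - b) ≤ f a := by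
  have hconv := hf.strictConvexOn.convexOn
  rcases lt_trichotomy a b with h | h | h
  · have := hconv.slope_le_of_hasDerivAt ha hb.le h (hf.hasDerivAt hb)
    rw [slope_def_field, div_le_iff₀ (by linarith)] at this
    linarith
  · simp [h]
  · have := hconv.le_slope_of_hasDerivAt hb.le ha h (hf.hasDerivAt hb)
    rw [slope_def_field, le_div_iff₀ (by linarith)] at this
    linarith

/-- If `f' ≤ z` throughout, the tangent at `t` evaluated at `1` bounds `f t` linearly in `t`,
against superlinearity. -/
lemma IsCongestionFunction.exists_lt_deriv (hf : IsCongestionFunction f) (z : ℝ) :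
    ∃ x, 0 < x ∧ z < deriv f x := by
  by_contra! h
  have hb : ∀ t, 1 ≤ t → f t / t ≤ |f 1| + |z| := by
    intro t ht
    have h1 := hf.tangent_le zero_le_one (zero_lt_one.trans_le ht)
    have h2 : deriv f t * (t - 1) ≤ z * (t - 1) :=
      mul_le_mul_of_nonneg_right (h t (by linarith)) (by linarith)
    have h3 : z * (t - 1) ≤ |z| * t := by
      nlinarith [le_abs_self z, abs_nonneg z]
    have h4 : f 1 ≤ |f 1| * t := by
      nlinarith [le_abs_self (f 1), abs_nonneg (f 1)]
    rw [div_le_iff₀ (by linarith)]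
    linarith
  obtain ⟨t, ht, ht1⟩ :=
    ((hf.superlinear.eventually_gt_atTop (|f 1| + |z|)).and (eventually_ge_atTop 1)).exists
  exact absurd (hb t ht1) (not_le.2 ht)

lemma IsCongestionFunction.exists_deriv_lt (hf : IsCongestionFunction f) (z : ℝ) :
    ∃ x, 0 < x ∧ deriv f x < z := by
  obtain ⟨x, hx, hx0⟩ :=
    ((hf.deriv_zero.eventually_lt_atBot z).and self_mem_nhdsWithin).exists
  exact ⟨x, hx0, hx⟩

lemma IsCongestionFunction.exists_deriv_eq (hf : IsCongestionFunction f) (z : ℝ) :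
    ∃ x ∈ Ioi (0 : ℝ), deriv f x = z := by
  obtain ⟨a, ha, haz⟩ := hf.exists_deriv_lt z
  obtain ⟨b, hb, hbz⟩ := hf.exists_lt_deriv z
  exact isPreconnected_Ioi.intermediate_value ha hb hf.continuousOn_deriv ⟨haz.le, hbz.le⟩

lemma IsCongestionFunction.derivInv_pos (hf : IsCongestionFunction f) (z : ℝ) :
    0 < derivInv f z :=
  Function.invFunOn_mem (hf.exists_deriv_eq z)

lemma IsCongestionFunction.deriv_derivInv (hf : IsCongestionFunction f) (z : ℝ) :
    deriv f (derivInv f z) = z :=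
  Function.invFunOn_eq (hf.exists_deriv_eq z)

lemma IsCongestionFunction.derivInv_deriv (hf : IsCongestionFunction f) {x : ℝ} (hx : 0 < x) :
    derivInv f (deriv f x) = x :=
  hf.strictMonoOn_deriv.injOn (hf.derivInv_pos _) hx (hf.deriv_derivInv _)

lemma IsCongestionFunction.strictMono_derivInv (hf : IsCongestionFunction f) :
    StrictMono (derivInv f) := by
  intro a b hab
  rwa [← hf.strictMonoOn_deriv.lt_iff_lt (hf.derivInv_pos a) (hf.derivInv_pos b),
    hf.deriv_derivInv, hf.deriv_derivInv]

/-- A monotone function can only jump, and the range contains all of `(0, ∞)`, which leaves no gap.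
-/
lemma IsCongestionFunction.continuous_derivInv (hf : IsCongestionFunction f) :
    Continuous (derivInv f) := by
  refine continuous_iff_continuousAt.2 fun z => ?_
  refine continuousAt_of_monotoneOn_of_image_mem_nhds (s := univ)
    (hf.strictMono_derivInv.monotone.monotoneOn _) univ_mem ?_
  refine mem_of_superset (Ioi_mem_nhds (hf.derivInv_pos z)) fun x hx => ?_
  exact ⟨deriv f x, mem_univ _, hf.derivInv_deriv hx⟩

/-- A congestion function is bounded below on `[0, ∞)`. -/
lemma IsCongestionFunction.exists_lower_bound (hf : IsCongestionFunction f) :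
    ∃ l : ℝ, ∀ a, 0 ≤ a → l ≤ f a := by
  obtain ⟨b, hb, hb0⟩ := hf.exists_deriv_eq 0
  exact ⟨f b, fun a ha => by simpa [hb0] using hf.tangent_le ha hb⟩

end CongestionFunction

/-! ### The mass function that defines `K_v`. -/

section MassFunction

variable {n : ℕ} {f : ℝ → ℝ} {Y : Set (E n)} {v : E n → ℝ} {R : ℝ}

lemma integrableOn_derivInv_comp (hf : IsCongestionFunction f) (hYm : MeasurableSet Y)
    (hY : volume Y ≠ ⊤) {w : E n → ℝ} (hw : Continuous w) (hwR : ∀ y ∈ Y, w y ≤ R) :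
    IntegrableOn (fun y => derivInv f (w y)) Y := by
  refine Measure.integrableOn_of_bounded (M := derivInv f R) hY
    (hf.continuous_derivInv.comp hw).aestronglyMeasurable ?_
  filter_upwards [ae_restrict_mem hYm] with y hy
  rw [Real.norm_of_nonneg (hf.derivInv_pos _).le]
  exact hf.strictMono_derivInv.monotone (hwR y hy)

lemma strictMono_mass (hf : IsCongestionFunction f) (hYm : MeasurableSet Y)
    (hY : volume Y ≠ ⊤) (hY0 : volume Y ≠ 0) (hv : Continuous v) (hvR : ∀ y ∈ Y, |v y| ≤ R) :
    StrictMono fun z : ℝ => ∫ y in Y, derivInv f (z - v y) := by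
  have hint : ∀ z : ℝ, IntegrableOn (fun y => derivInv f (z - v y)) Y := fun z =>
    integrableOn_derivInv_comp (R := z + R) hf hYm hY (by fun_prop)
      fun y hy => by linarith [neg_le_of_abs_le (hvR y hy)]
  intro a b hab
  have hlt : ∀ y, derivInv f (a - v y) < derivInv f (b - v y) :=
    fun y => hf.strictMono_derivInv (by linarith)
  have hpos : 0 < ∫ y in Y, (derivInv f (b - v y) - derivInv f (a - v y)) := by
    rw [integral_pos_iff_support_of_nonneg (fun y => (sub_pos.2 (hlt y)).le)
      ((hint b).sub (hint a))]
    have : (Function.support fun y => derivInv f (b - v y) - derivInv f (a - v y)) = univ :=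
      eq_univ_of_forall fun y => (sub_pos.2 (hlt y)).ne'
    rw [this, Measure.restrict_apply_univ]
    exact pos_iff_ne_zero.2 hY0
  rw [integral_sub (hint b) (hint a)] at hpos
  simpa using hpos

lemma continuousOn_mass (hf : IsCongestionFunction f) (hYm : MeasurableSet Y)
    (hY : volume Y ≠ ⊤) (hv : Continuous v) (hvR : ∀ y ∈ Y, |v y| ≤ R) (a b : ℝ) :
    ContinuousOn (fun z : ℝ => ∫ y in Y, derivInv f (z - v y)) (Icc a b) := by
  refine continuousOn_of_dominated (bound := fun _ => derivInv f (b + R)) ?_ ?_ ?_ ?_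
  · exact fun z _ => (hf.continuous_derivInv.comp (by fun_prop)).aestronglyMeasurable
  · intro z hz
    filter_upwards [ae_restrict_mem hYm] with y hy
    rw [Real.norm_of_nonneg (hf.derivInv_pos _).le]
    exact hf.strictMono_derivInv.monotone (by linarith [neg_le_of_abs_le (hvR y hy), hz.2])
  · exact integrableOn_const hY
  · exact ae_of_all _ fun y => (hf.continuous_derivInv.comp (by fun_prop)).continuousOn

/-- `K_v(1)` lies between any two points where the mass function is at most, respectively at
least, one. -/
lemma K_one_mem_Icc (hf : IsCongestionFunction f) (hYm : MeasurableSet Y)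
    (hY : volume Y ≠ ⊤) (hY0 : volume Y ≠ 0) (hv : Continuous v) (hvR : ∀ y ∈ Y, |v y| ≤ R)
    {a b : ℝ} (ha : ∫ y in Y, derivInv f (a - v y) ≤ 1)
    (hb : 1 ≤ ∫ y in Y, derivInv f (b - v y)) : K Y f v 1 ∈ Icc a b := by
  have hmono := strictMono_mass hf hYm hY hY0 hv hvR
  have hab : a ≤ b := hmono.le_iff_le.1 (ha.trans hb)
  obtain ⟨z, -, hz⟩ :=
    intermediate_value_Icc hab (continuousOn_mass hf hYm hY hv hvR a b) ⟨ha, hb⟩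
  -- `Function.invFun` is a genuine preimage only where one exists; the intermediate value `z`
  -- supplies it.
  have hK : ∫ y in Y, derivInv f (K Y f v 1 - v y) = 1 :=
    Function.invFun_eq (f := fun z : ℝ => ∫ y in Y, derivInv f (z - v y)) ⟨z, hz⟩
  exact ⟨hmono.le_iff_le.1 (ha.trans_eq hK.symm), hmono.le_iff_le.1 (hK.trans_le hb)⟩

end MassFunction

end CongestionOT

namespace CongestionOT

/-! ### Couplings and integrability of the cost. -/

section Transport

variable {m n : ℕ} {S : Set (E m)} {T : Set (E n)} {c : E m → E n → ℝ}
  {μ : Measure (E m)} {ν : Measure (E n)} {γ : Measure (E m × E n)}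

lemma ae_mem_of_mem_probOn {k : ℕ} {S : Set (E k)} {ρ : Measure (E k)} (hρ : ρ ∈ probOn S) :
    ∀ᵐ x ∂ρ, x ∈ S :=
  hρ.2

lemma isProbabilityMeasure_of_mem_couplings (hμ : μ ∈ probOn S) (hγ : γ ∈ couplings μ ν) :
    IsProbabilityMeasure γ := by
  have := hμ.1
  refine ⟨?_⟩
  have h : γ.map Prod.fst univ = 1 := by rw [hγ.1]; exact measure_univ
  rwa [Measure.map_apply measurable_fst MeasurableSet.univ, preimage_univ] at h

lemma ae_mem_prod_of_mem_couplings (hμ : μ ∈ probOn S) (hν : ν ∈ probOn T)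
    (hγ : γ ∈ couplings μ ν) : ∀ᵐ p ∂γ, p ∈ S ×ˢ T := by
  have h1 : ∀ᵐ p ∂γ, p.1 ∈ S :=
    ae_of_ae_map measurable_fst.aemeasurable (by rw [hγ.1]; exact ae_mem_of_mem_probOn hμ)
  have h2 : ∀ᵐ p ∂γ, p.2 ∈ T :=
    ae_of_ae_map measurable_snd.aemeasurable (by rw [hγ.2]; exact ae_mem_of_mem_probOn hν)
  filter_upwards [h1, h2] with p hp1 hp2 using ⟨hp1, hp2⟩

lemma prod_mem_couplings (hμ : μ ∈ probOn S) (hν : ν ∈ probOn T) :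
    μ.prod ν ∈ couplings μ ν := by
  have := hμ.1
  have := hν.1
  exact ⟨by simp [Measure.map_fst_prod], by simp [Measure.map_snd_prod]⟩

lemma integrable_cost (hS : IsCompact S) (hT : IsCompact T)
    (hc : ContinuousOn (fun p : E m × E n => c p.1 p.2) (S ×ˢ T)) [IsFiniteMeasure γ]
    (hγ : ∀ᵐ p ∂γ, p ∈ S ×ˢ T) : Integrable (fun p : E m × E n => c p.1 p.2) γ := by
  have h := hc.integrableOn_compact (μ := γ) (hS.prod hT)
  rwa [IntegrableOn, Measure.restrict_eq_self_of_ae_mem hγ] at h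

/-- Needed because the real `sInf` is a lower bound only for sets that are bounded below. -/
lemma bddBelow_costs (hS : IsCompact S) (hT : IsCompact T)
    (hc : ContinuousOn (fun p : E m × E n => c p.1 p.2) (S ×ˢ T))
    (hμ : μ ∈ probOn S) (hν : ν ∈ probOn T) :
    BddBelow ((fun γ : Measure (E m × E n) => ∫ p, c p.1 p.2 ∂γ) '' couplings μ ν) := by
  obtain ⟨C, hC⟩ := (hS.prod hT).bddBelow_image hc
  refine ⟨C, ?_⟩
  rintro _ ⟨γ, hγ, rfl⟩
  have := isProbabilityMeasure_of_mem_couplings hμ hγ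
  have hmem := ae_mem_prod_of_mem_couplings hμ hν hγ
  have h : ∫ _, C ∂γ ≤ ∫ p, c p.1 p.2 ∂γ := by
    refine integral_mono_ae (integrable_const C) (integrable_cost hS hT hc hmem) ?_
    filter_upwards [hmem] with p hp using hC (mem_image_of_mem _ hp)
  simpa using h

end Transport

/-! ### Moving mass from `A` to `B`, and its transport cost. -/

section Transfer

variable {m n : ℕ}

/-- The measure obtained from `ν` by moving the fraction `t` of the mass in `A` to `B`, where it
is distributed uniformly. -/
noncomputable def transfer (ν : Measure (E n)) (A B : Set (E n)) (t : ℝ) : Measure (E n) :=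
  ν.restrict Aᶜ + ENNReal.ofReal (1 - t) • ν.restrict A
    + (ENNReal.ofReal t / volume B * ν A) • volume.restrict B

/-- The coupling obtained from `γ` by moving the fraction `t` of the mass over `A` to `B`,
independently of the point it is coupled with. -/
noncomputable def transferCoupling (γ : Measure (E m × E n)) (A B : Set (E n)) (t : ℝ) :
    Measure (E m × E n) :=
  γ.restrict (Prod.snd ⁻¹' Aᶜ) + ENNReal.ofReal (1 - t) • γ.restrict (Prod.snd ⁻¹' A)
    + (ENNReal.ofReal t / volume B) •
      ((γ.restrict (Prod.snd ⁻¹' A)).map Prod.fst).prod (volume.restrict B)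

variable {μ : Measure (E m)} {ν : Measure (E n)} {A B : Set (E n)} {t : ℝ}

lemma ofReal_one_sub_add (ht0 : 0 ≤ t) (ht1 : t ≤ 1) :
    ENNReal.ofReal (1 - t) + ENNReal.ofReal t = 1 := by
  rw [← ENNReal.ofReal_add (by linarith) ht0]
  simp

/-- The product term returns to the first marginal exactly the fraction `t` removed over `A`, since
the factor `volume B` cancels; only the second marginal changes. -/
lemma transferCoupling_mem_couplings {γ : Measure (E m × E n)} [IsFiniteMeasure γ]
    (hγ : γ ∈ couplings μ ν) (hA : MeasurableSet A)
    (hB0 : volume B ≠ 0) (hB : volume B ≠ ⊤) (ht0 : 0 ≤ t) (ht1 : t ≤ 1) :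
    transferCoupling γ A B t ∈ couplings μ (transfer ν A B t) := by
  have hfin : Fact (volume B < ⊤) := ⟨hB.lt_top⟩
  constructor
  · rw [transferCoupling, Measure.map_add _ _ measurable_fst, Measure.map_add _ _ measurable_fst,
      Measure.map_smul, Measure.map_smul, Measure.map_fst_prod, Measure.restrict_apply_univ,
      smul_smul, ENNReal.div_mul_cancel hB0 hB, add_assoc, ← add_smul, ofReal_one_sub_add ht0 ht1,
      one_smul, ← Measure.map_add _ _ measurable_fst, preimage_compl, add_comm,
      Measure.restrict_add_restrict_compl (measurable_snd hA), hγ.1]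
  · rw [transferCoupling, Measure.map_add _ _ measurable_snd, Measure.map_add _ _ measurable_snd,
      Measure.map_smul, Measure.map_smul, Measure.map_snd_prod,
      ← Measure.restrict_map measurable_snd hA, ← Measure.restrict_map measurable_snd hA.compl,
      hγ.2, smul_smul, Measure.map_apply measurable_fst MeasurableSet.univ, preimage_univ,
      Measure.restrict_apply_univ, ← Measure.map_apply measurable_snd hA, hγ.2, transfer]

lemma transfer_mem_probOn {T : Set (E n)} (hν : ν ∈ probOn T) (hA : MeasurableSet A)
    (hBm : MeasurableSet B) (hBT : B ⊆ T)
    (hB0 : volume B ≠ 0) (hB : volume B ≠ ⊤) (ht0 : 0 ≤ t) (ht1 : t ≤ 1) :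
    transfer ν A B t ∈ probOn T := by
  have := hν.1
  have hT := hν.2
  refine ⟨⟨?_⟩, ?_⟩
  · simp only [transfer, Measure.add_apply, Measure.smul_apply, smul_eq_mul,
      Measure.restrict_apply_univ]
    rw [mul_right_comm, ENNReal.div_mul_cancel hB0 hB, add_assoc, ← add_mul,
      ofReal_one_sub_add ht0 ht1, one_mul, add_comm, measure_add_measure_compl hA, measure_univ]
  · have h1 : ν.restrict A Tᶜ = 0 := Measure.absolutelyContinuous_of_le Measure.restrict_le_self hT
    have h2 : ν.restrict Aᶜ Tᶜ = 0 := Measure.absolutelyContinuous_of_le Measure.restrict_le_self hT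
    have h3 : (volume.restrict B) Tᶜ = 0 := by
      rw [Measure.restrict_apply' hBm, (disjoint_compl_left_iff_subset.2 hBT).inter_eq,
        measure_empty]
    simp [transfer, h1, h2, h3]

/-- Moving the fraction `t` of the mass in `A` to `B` raises the transport cost by at most `tν(A)L`
if moving a point of `A` to a point of `B` raises the cost by at most `L`. -/
lemma transportCost_transfer_le {S : Set (E m)} {T : Set (E n)} {c : E m → E n → ℝ}
    (hS : IsCompact S) (hT : IsCompact T)
    (hc : ContinuousOn (fun p : E m × E n => c p.1 p.2) (S ×ˢ T))
    (hμ : μ ∈ probOn S) (hν : ν ∈ probOn T) (hA : MeasurableSet A)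
    (hBm : MeasurableSet B) (hBT : B ⊆ T)
    (hB0 : volume B ≠ 0) (hB : volume B ≠ ⊤) (ht0 : 0 ≤ t) (ht1 : t ≤ 1) {L : ℝ}
    (hL : ∀ x ∈ S, ∀ y ∈ A ∩ T, ∀ y' ∈ B, c x y' ≤ c x y + L) :
    transportCost c μ (transfer ν A B t) ≤ transportCost c μ ν + t * ν.real A * L := by
  have hν' := transfer_mem_probOn hν hA hBm hBT hB0 hB ht0 ht1
  have hfin : IsFiniteMeasure (volume.restrict B) := ⟨by simpa using hB.lt_top⟩
  -- With the infimum for `ν` isolated, it suffices to modify an arbitrary coupling `γ`, so no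
  -- optimal one is required.
  rw [← sub_le_iff_le_add]
  refine le_csInf ⟨_, mem_image_of_mem _ (prod_mem_couplings hμ hν)⟩ ?_
  rintro _ ⟨γ, hγ, rfl⟩
  rw [sub_le_iff_le_add]
  have hγp := isProbabilityMeasure_of_mem_couplings hμ hγ
  have hγ' := transferCoupling_mem_couplings hγ hA hB0 hB ht0 ht1
  refine (csInf_le (bddBelow_costs hS hT hc hμ hν') (mem_image_of_mem _ hγ')).trans ?_
  have hmem := ae_mem_prod_of_mem_couplings hμ hν hγ
  have hint := integrable_cost hS hT hc hmem
  set γA := γ.restrict (Prod.snd ⁻¹' A) with hγA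
  have hA' : MeasurableSet (Prod.snd ⁻¹' A : Set (E m × E n)) := measurable_snd hA
  have hintA : Integrable (fun p : E m × E n => c p.1 p.2) γA :=
    hint.mono_measure Measure.restrict_le_self
  have hfst : ∀ᵐ x ∂(γA.map Prod.fst), x ∈ S := by
    refine (ae_map_iff (p := (· ∈ S)) measurable_fst.aemeasurable
      hS.isClosed.measurableSet).2 ?_
    exact ae_restrict_of_ae (hmem.mono fun p hp => hp.1)
  have hprod : ∀ᵐ p ∂((γA.map Prod.fst).prod (volume.restrict B)), p ∈ S ×ˢ T := by
    have h1 := Measure.quasiMeasurePreserving_fst (μ := γA.map Prod.fst)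
      (ν := volume.restrict B) |>.ae hfst
    have h2 := Measure.quasiMeasurePreserving_snd (μ := γA.map Prod.fst)
      (ν := volume.restrict B) |>.ae (ae_restrict_mem hBm)
    filter_upwards [h1, h2] with p hp1 hp2 using ⟨hp1, hBT hp2⟩
  have hintP := integrable_cost hS hT hc hprod
  have hP : ∫ p, c p.1 p.2 ∂((γA.map Prod.fst).prod (volume.restrict B))
      = ∫ p, (∫ y in B, c p.1 y) ∂γA := by
    rw [integral_prod _ hintP]
    exact integral_map measurable_fst.aemeasurable hintP.integral_prod_left.aestronglyMeasurable
  have hintI : Integrable (fun p : E m × E n => ∫ y in B, c p.1 y) γA :=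
    (integrable_map_measure hintP.integral_prod_left.aestronglyMeasurable
      measurable_fst.aemeasurable).1 hintP.integral_prod_left
  -- The pointwise bound `hL`, averaged over the destination in `B` and integrated over the mass
  -- above `A`.
  have hle : ∫ p, (∫ y in B, c p.1 y) ∂γA
      ≤ volume.real B * (∫ p, c p.1 p.2 ∂γA + ν.real A * L) := by
    have hmass : γA.real univ = ν.real A := by
      rw [measureReal_def, measureReal_def, hγA, Measure.restrict_apply_univ,
        ← Measure.map_apply measurable_snd hA, hγ.2]
    have h1 : ∫ p, (∫ y in B, c p.1 y) ∂γA
        ≤ ∫ p, volume.real B * (c p.1 p.2 + L) ∂γA := by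
      refine integral_mono_ae hintI ((hintA.add (integrable_const L)).const_mul _) ?_
      filter_upwards [ae_restrict_of_ae hmem, ae_restrict_mem hA'] with p hp hpA
      have hcont : ContinuousOn (fun y => c p.1 y) T :=
        hc.comp (f := fun y => (p.1, y)) (by fun_prop) fun y hy => ⟨hp.1, hy⟩
      have hi : IntegrableOn (fun y => c p.1 y) B :=
        (hcont.integrableOn_compact hT).mono_set hBT
      have := setIntegral_mono_on hi (integrableOn_const hB) hBm
        fun y hy => hL p.1 hp.1 p.2 ⟨hpA, hp.2⟩ y hy
      simpa using this
    refine h1.trans_eq ?_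
    rw [integral_const_mul, integral_add hintA (integrable_const L), integral_const, hmass,
      smul_eq_mul]
  have hsplit : ∫ p, c p.1 p.2 ∂(γ.restrict (Prod.snd ⁻¹' Aᶜ)) + ∫ p, c p.1 p.2 ∂γA
      = ∫ p, c p.1 p.2 ∂γ := by
    rw [add_comm, preimage_compl]
    exact integral_add_compl hA' hint
  have hBr : 0 < volume.real B := ENNReal.toReal_pos hB0 hB
  have hr : ENNReal.ofReal t / volume B ≠ ⊤ := ENNReal.div_ne_top ENNReal.ofReal_ne_top hB0
  have hi1 : Integrable (fun p : E m × E n => c p.1 p.2) (γ.restrict (Prod.snd ⁻¹' Aᶜ)) :=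
    hint.mono_measure Measure.restrict_le_self
  have hi2 := hintA.smul_measure (ENNReal.ofReal_ne_top (r := 1 - t))
  have hi3 := hintP.smul_measure hr
  beta_reduce
  rw [transferCoupling, integral_add_measure (hi1.add_measure hi2) hi3,
    integral_add_measure hi1 hi2, integral_smul_measure, integral_smul_measure, hP,
    ENNReal.toReal_ofReal (by linarith), ENNReal.toReal_div, ENNReal.toReal_ofReal ht0,
    ← measureReal_def, smul_eq_mul, smul_eq_mul, ← hsplit]
  have h2 := mul_le_mul_of_nonneg_left hle (div_nonneg ht0 hBr.le)
  have h3 : t / volume.real B * (volume.real B * (∫ p, c p.1 p.2 ∂γA + ν.real A * L))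
      = t * (∫ p, c p.1 p.2 ∂γA) + t * ν.real A * L := by
    field_simp
  linarith

end Transfer

end CongestionOT

namespace CongestionOT

/-! ### Effect of a transfer on the density and on the congestion. -/

section Density

variable {n : ℕ} {f : ℝ → ℝ} {Y A B : Set (E n)} {ν : Measure (E n)}

lemma density_nonneg (ν : Measure (E n)) (y : E n) : 0 ≤ density ν y :=
  ENNReal.toReal_nonneg

lemma measurable_density (ν : Measure (E n)) : Measurable (density ν) :=
  (Measure.measurable_rnDeriv ν volume).ennreal_toReal

/-- Convexity on `[0, ∞)` allows a jump of `f` at `0`, so that value is treated as a separate piece.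
-/
lemma IsCongestionFunction.measurable_comp (hf : IsCongestionFunction f) {u : E n → ℝ}
    (hu : Measurable u) (hu0 : ∀ y, 0 ≤ u y) : Measurable fun y => f (u y) := by
  classical
  have hm : Measurable ((Ioi (0 : ℝ)).piecewise f fun _ => f 0) :=
    hf.contDiffOn.continuousOn.measurable_piecewise continuousOn_const measurableSet_Ioi
  convert hm.comp hu using 1
  funext y
  rcases (hu0 y).eq_or_lt with h | h
  · simp [← h]
  · simp [Set.piecewise, h]

lemma setIntegral_density [IsFiniteMeasure ν] (hν : ν ≪ volume.restrict Y) (s : Set (E n)) :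
    ∫ y in s, density ν y = ν.real s :=
  Measure.setIntegral_toReal_rnDeriv (hν.trans Measure.absolutelyContinuous_restrict) s

lemma integrable_density (ν : Measure (E n)) [IsFiniteMeasure ν] : Integrable (density ν) :=
  Measure.integrable_toReal_rnDeriv

/-- The density of a transferred measure. -/
lemma density_transfer [IsFiniteMeasure ν] (hA : MeasurableSet A) (hBm : MeasurableSet B)
    (hB0 : volume B ≠ 0) (hB : volume B ≠ ⊤) {t : ℝ} (ht0 : 0 ≤ t) (ht1 : t ≤ 1) :
    ∀ᵐ y, density (transfer ν A B t) y = density ν y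
      + A.indicator (fun y => -(t * density ν y)) y
      + B.indicator (fun _ => t / volume.real B * ν.real A) y := by
  have hfin : IsFiniteMeasure (volume.restrict B) := ⟨by simpa using hB.lt_top⟩
  have hr : ENNReal.ofReal t / volume B * ν A ≠ ⊤ :=
    ENNReal.mul_ne_top (ENNReal.div_ne_top ENNReal.ofReal_ne_top hB0) (measure_ne_top _ _)
  have hf2 : IsFiniteMeasure (ENNReal.ofReal (1 - t) • ν.restrict A) :=
    Measure.smul_finite _ ENNReal.ofReal_ne_top
  have hf3 : IsFiniteMeasure ((ENNReal.ofReal t / volume B * ν A) • volume.restrict B) :=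
    Measure.smul_finite _ hr
  have hdec : (ν.restrict Aᶜ + ENNReal.ofReal (1 - t) • ν.restrict A
      + (ENNReal.ofReal t / volume B * ν A) • volume.restrict B).HaveLebesgueDecomposition
        volume := Measure.haveLebesgueDecomposition_of_sigmaFinite _ _
  filter_upwards [
    Measure.rnDeriv_add (ν.restrict Aᶜ + ENNReal.ofReal (1 - t) • ν.restrict A)
      ((ENNReal.ofReal t / volume B * ν A) • volume.restrict B) volume,
    Measure.rnDeriv_add (ν.restrict Aᶜ) (ENNReal.ofReal (1 - t) • ν.restrict A) volume,
    Measure.rnDeriv_smul_left_of_ne_top (ν.restrict A) volume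
      (ENNReal.ofReal_ne_top (r := 1 - t)),
    Measure.rnDeriv_smul_left_of_ne_top (volume.restrict B) volume hr,
    Measure.rnDeriv_restrict ν volume hA, Measure.rnDeriv_restrict ν volume hA.compl,
    Measure.rnDeriv_restrict_self (volume : Measure (E n)) hBm,
    Measure.rnDeriv_lt_top ν volume] with y h1 h2 h3 h4 h5 h6 h7 h8
  have hB1 : (ENNReal.ofReal t / volume B * ν A).toReal = t / volume.real B * ν.real A := by
    rw [ENNReal.toReal_mul, ENNReal.toReal_div, ENNReal.toReal_ofReal ht0]
    rfl
  rw [density, transfer, h1, Pi.add_apply, h2, Pi.add_apply, h3, h4, Pi.smul_apply, Pi.smul_apply,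
    h5, h6, h7, smul_eq_mul, smul_eq_mul]
  have key : ∀ a b : ENNReal, a ≠ ⊤ → b ≠ ⊤ → (a + b).toReal = a.toReal + b.toReal :=
    fun a b ha hb => ENNReal.toReal_add ha hb
  have e1 : (Aᶜ.indicator (ν.rnDeriv volume) y
      + ENNReal.ofReal (1 - t) * A.indicator (ν.rnDeriv volume) y)
      ≠ ⊤ ∧ (Aᶜ.indicator (ν.rnDeriv volume) y
      + ENNReal.ofReal (1 - t) * A.indicator (ν.rnDeriv volume) y).toReal
      = density ν y + A.indicator (fun y => -(t * density ν y)) y := by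
    by_cases hy : y ∈ A
    · have hyc : y ∉ Aᶜ := fun h => h hy
      simp only [indicator_of_mem hy, indicator_of_notMem hyc, zero_add]
      refine ⟨ENNReal.mul_ne_top ENNReal.ofReal_ne_top h8.ne, ?_⟩
      rw [ENNReal.toReal_mul, ENNReal.toReal_ofReal (by linarith), density]
      ring
    · have hyc : y ∈ Aᶜ := hy
      simp only [indicator_of_notMem hy, indicator_of_mem hyc, mul_zero, add_zero]
      exact ⟨h8.ne, rfl⟩
  have e2 : ENNReal.ofReal t / volume B * ν A * B.indicator 1 y ≠ ⊤ ∧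
      (ENNReal.ofReal t / volume B * ν A * B.indicator 1 y).toReal
        = B.indicator (fun _ => t / volume.real B * ν.real A) y := by
    by_cases hy : y ∈ B
    · simp only [indicator_of_mem hy, Pi.one_apply, mul_one]
      exact ⟨hr, hB1⟩
    · simp [indicator_of_notMem hy]
  rw [key _ _ e1.1 e2.1, e1.2, e2.2]

/-- The change of the congestion integral when a fraction of the mass is transferred from a set of
higher density to a set of lower density. -/
lemma congestion_transfer_le [IsFiniteMeasure ν] (hf : IsCongestionFunction f)
    (hY : volume Y ≠ ⊤) (hν : ν ≪ volume.restrict Y)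
    (hint : IntegrableOn (fun y => f (density ν y)) Y)
    (hA : MeasurableSet A) (hBm : MeasurableSet B) (hAY : A ⊆ Y) (hBY : B ⊆ Y)
    (hAB : Disjoint A B) (hB0 : volume B ≠ 0) (hνA : 0 < ν.real A) {s s' t : ℝ} (hs : 0 < s)
    (hsA : ∀ y ∈ A, s < density ν y) (hsB : ∀ y ∈ B, density ν y < s') (ht0 : 0 < t)
    (ht1 : t < 1) :
    IntegrableOn (fun y => f (density (transfer ν A B t) y)) Y ∧
    ∫ y in Y, f (density (transfer ν A B t) y) ≤ (∫ y in Y, f (density ν y))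
      + t * ν.real A * (deriv f (s' + t / volume.real B * ν.real A) - deriv f ((1 - t) * s)) := by
  have hB : volume B ≠ ⊤ := measure_ne_top_of_subset hBY hY
  have hBr : 0 < volume.real B := ENNReal.toReal_pos hB0 hB
  set κ := t / volume.real B * ν.real A with hκ
  have hκ0 : 0 < κ := by positivity
  -- An upper bound for the new integrand, from tangents at the new density: the old density may
  -- vanish on `B`, where `f'` has no value to use. Monotonicity of `f'` then replaces the slopes by
  -- constants at `(1 - t) * s` on `A` and at `s' + κ` on `B`.
  set g : E n → ℝ := fun y => f (density ν y)
    + A.indicator (fun y => -(t * deriv f ((1 - t) * s)) * density ν y) y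
    + B.indicator (fun _ => κ * deriv f (s' + κ)) y with hg
  have hgA : IntegrableOn
      (A.indicator fun y => -(t * deriv f ((1 - t) * s)) * density ν y) Y :=
    (((integrable_density ν).const_mul _).indicator hA).integrableOn
  have hgB : IntegrableOn (B.indicator fun _ => κ * deriv f (s' + κ)) Y :=
    (show IntegrableOn (fun _ => κ * deriv f (s' + κ)) Y from integrableOn_const hY).indicator hBm
  have hgi : IntegrableOn g Y := (hint.add hgA).add hgB
  have hle : ∀ᵐ y ∂(volume.restrict Y), f (density (transfer ν A B t) y) ≤ g y := by
    filter_upwards [ae_restrict_of_ae (density_transfer (ν := ν) hA hBm hB0 hB ht0.le ht1.le)]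
      with y hy
    rw [hy]
    by_cases hyA : y ∈ A
    · have hyB : y ∉ B := fun h => hAB.le_bot ⟨hyA, h⟩
      simp only [hg, indicator_of_mem hyA, indicator_of_notMem hyB, add_zero]
      have hρ := hsA y hyA
      have hρ0 : 0 < density ν y := hs.trans hρ
      have h1t : 0 < 1 - t := by linarith
      have h1 := hf.tangent_le hρ0.le (mul_pos h1t hρ0)
      have h2 : deriv f ((1 - t) * s) ≤ deriv f ((1 - t) * density ν y) :=
        hf.strictMonoOn_deriv.monotoneOn (mul_pos h1t hs) (mul_pos h1t hρ0)
          (mul_le_mul_of_nonneg_left hρ.le h1t.le)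
      have h3 := mul_le_mul_of_nonneg_right h2 (mul_pos ht0 hρ0).le
      have h4 : density ν y + -(t * density ν y) = (1 - t) * density ν y := by ring
      rw [h4]
      linarith
    · by_cases hyB : y ∈ B
      · simp only [hg, indicator_of_notMem hyA, indicator_of_mem hyB, add_zero]
        have hρ := hsB y hyB
        have hρ0 := density_nonneg ν y
        have h1 := hf.tangent_le hρ0 (show 0 < density ν y + κ by linarith)
        have h2 : deriv f (density ν y + κ) ≤ deriv f (s' + κ) :=
          hf.strictMonoOn_deriv.monotoneOn (show 0 < density ν y + κ by linarith)
            (show 0 < s' + κ by linarith) (by linarith)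
        have h3 := mul_le_mul_of_nonneg_right h2 hκ0.le
        linarith
      · simp [hg, hyA, hyB]
  obtain ⟨l, hl⟩ := hf.exists_lower_bound
  have hint' : IntegrableOn (fun y => f (density (transfer ν A B t) y)) Y :=
    integrable_of_le_of_le
      (hf.measurable_comp (measurable_density _) (density_nonneg _)).aestronglyMeasurable
      (ae_of_all _ fun y => hl _ (density_nonneg _ y)) hle (integrableOn_const hY) hgi
  refine ⟨hint', (integral_mono_ae hint' hgi hle).trans_eq ?_⟩
  have hiA : ∫ y in Y, A.indicator (fun y => -(t * deriv f ((1 - t) * s)) * density ν y) y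
      = -(t * deriv f ((1 - t) * s)) * ν.real A := by
    rw [setIntegral_indicator hA, inter_eq_right.2 hAY, integral_const_mul,
      setIntegral_density hν]
  have hiB : ∫ y in Y, B.indicator (fun _ => κ * deriv f (s' + κ)) y
      = t * ν.real A * deriv f (s' + κ) := by
    rw [setIntegral_indicator hBm, inter_eq_right.2 hBY, setIntegral_const, smul_eq_mul, hκ]
    field_simp
  have hsum := integral_add (hint.add hgA) hgB
  simp only [Pi.add_apply] at hsum
  rw [hg, hsum, integral_add hint hgA, hiA, hiB]
  ring

lemma transfer_absolutelyContinuous (hν : ν ≪ volume.restrict Y) (hBY : B ⊆ Y) (t : ℝ) :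
    transfer ν A B t ≪ volume.restrict Y := by
  have h1 : ∀ s, ν.restrict s ≪ volume.restrict Y := fun s =>
    (Measure.absolutelyContinuous_of_le Measure.restrict_le_self).trans hν
  have h2 : volume.restrict B ≪ volume.restrict Y :=
    Measure.absolutelyContinuous_of_le (Measure.restrict_mono hBY le_rfl)
  exact (((h1 _).add_left ((h1 _).smul_left _))).add_left (h2.smul_left _)

end Density

/-! ### Finite energy and the exchange inequality. -/

section Minimizer

variable {m n : ℕ} {X : Set (E m)} {Y A B : Set (E n)} {c : E m → E n → ℝ} {f : ℝ → ℝ}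
  {μ : Measure (E m)} {ν ν' : Measure (E n)}

/-- The uniform distribution has finite congestion. -/
lemma exists_congestion_ne_top (hYm : MeasurableSet Y) (hY : volume Y ≠ ⊤) (hY0 : volume Y ≠ 0) :
    ∃ ρ ∈ probOn (closure Y), congestion Y f ρ ≠ ⊤ := by
  have hfin : IsFiniteMeasure (volume.restrict Y) := ⟨by simpa using hY.lt_top⟩
  have hac : (volume Y)⁻¹ • volume.restrict Y ≪ volume.restrict Y :=
    Measure.AbsolutelyContinuous.rfl.smul_left _
  refine ⟨(volume Y)⁻¹ • volume.restrict Y, ⟨⟨?_⟩, ?_⟩, ?_⟩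
  · simp [ENNReal.inv_mul_cancel hY0 hY]
  · refine hac ?_
    rw [Measure.restrict_apply' hYm,
      (disjoint_compl_left_iff_subset.2 subset_closure).inter_eq, measure_empty]
  · have hd : (fun y => f (density ((volume Y)⁻¹ • volume.restrict Y) y))
        =ᵐ[volume.restrict Y] fun _ => f (volume Y)⁻¹.toReal := by
      filter_upwards [
        ae_restrict_of_ae (Measure.rnDeriv_smul_left_of_ne_top (volume.restrict Y) volume
          (ENNReal.inv_ne_top.2 hY0)),
        ae_restrict_of_ae (Measure.rnDeriv_restrict_self (volume : Measure (E n)) hYm),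
        ae_restrict_mem hYm] with y h1 h2 h3
      rw [density, h1, Pi.smul_apply, h2, indicator_of_mem h3]
      simp
    have hi : IntegrableOn (fun y => f (density ((volume Y)⁻¹ • volume.restrict Y) y)) Y :=
      (integrable_congr hd).2 (integrable_const _)
    rw [congestion, if_pos ⟨hac, hi⟩]
    exact EReal.coe_ne_top _

/-- Otherwise the energy is `⊤`, while the uniform distribution has finite energy. -/
lemma IsMinimizer.finite_congestion (hν : IsMinimizer Y c f μ ν) (hYm : MeasurableSet Y)
    (hY : volume Y ≠ ⊤) (hY0 : volume Y ≠ 0) :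
    ν ≪ volume.restrict Y ∧ IntegrableOn (fun y => f (density ν y)) Y := by
  obtain ⟨ρ, hρ, hρf⟩ := exists_congestion_ne_top (f := f) hYm hY hY0
  by_contra h
  have hle : energy Y c f μ ν ≤ energy Y c f μ ρ := hν.2 hρ
  rw [energy, congestion, if_neg h, EReal.coe_add_top, top_le_iff, energy] at hle
  exact EReal.add_ne_top (EReal.coe_ne_top _) hρf hle

lemma IsMinimizer.le_of_finite_congestion (hν : IsMinimizer Y c f μ ν)
    (hfin : ν ≪ volume.restrict Y ∧ IntegrableOn (fun y => f (density ν y)) Y)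
    (hν' : ν' ∈ probOn (closure Y))
    (hfin' : ν' ≪ volume.restrict Y ∧ IntegrableOn (fun y => f (density ν' y)) Y) :
    transportCost c μ ν + ∫ y in Y, f (density ν y)
      ≤ transportCost c μ ν' + ∫ y in Y, f (density ν' y) := by
  have hle : energy Y c f μ ν ≤ energy Y c f μ ν' := hν.2 hν'
  rw [energy, energy, congestion, congestion, if_pos hfin, if_pos hfin'] at hle
  exact_mod_cast hle

/-- A minimizer cannot gain by moving mass from a set of higher density to a set of lower
density. -/
lemma IsMinimizer.null_or_null (hν : IsMinimizer Y c f μ ν) (hX : IsCompact (closure X))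
    (hYc : IsCompact (closure Y)) (hYm : MeasurableSet Y) (hY0 : volume Y ≠ 0)
    (hc : ContinuousOn (fun p : E m × E n => c p.1 p.2) (closure X ×ˢ closure Y))
    (hf : IsCongestionFunction f) (hμ : μ ∈ probOn (closure X))
    (hA : MeasurableSet A) (hBm : MeasurableSet B) (hAY : A ⊆ Y) (hBY : B ⊆ Y)
    {s s' L : ℝ} (hs : 0 < s) (hs' : 0 < s') (hL0 : 0 ≤ L)
    (hsA : ∀ y ∈ A, s < density ν y) (hsB : ∀ y ∈ B, density ν y < s')
    (hL : ∀ x ∈ closure X, ∀ y ∈ A, ∀ y' ∈ B, c x y' ≤ c x y + L)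
    (hlt : deriv f s' + L < deriv f s) : volume A = 0 ∨ volume B = 0 := by
  by_contra! h
  obtain ⟨hA0, hB0⟩ := h
  have := hν.1.1
  have hY : volume Y ≠ ⊤ := measure_ne_top_of_subset subset_closure hYc.measure_lt_top.ne
  have hfin := hν.finite_congestion hYm hY hY0
  have hAt : volume A ≠ ⊤ := measure_ne_top_of_subset hAY hY
  have hBt : volume B ≠ ⊤ := measure_ne_top_of_subset hBY hY
  have hss : s' < s := (hf.strictMonoOn_deriv.lt_iff_lt hs' hs).1 (by linarith)
  have hAB : Disjoint A B := Set.disjoint_left.2 fun y h1 h2 => by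
    linarith [hsA y h1, hsB y h2]
  have hνA : 0 < ν.real A := by
    have h1 : ∫ _ in A, s ≤ ∫ y in A, density ν y :=
      setIntegral_mono_on (integrableOn_const hAt) (integrable_density ν).integrableOn hA
        fun y hy => (hsA y hy).le
    rw [setIntegral_density hfin.1, setIntegral_const, smul_eq_mul] at h1
    exact (mul_pos (ENNReal.toReal_pos hA0 hAt) hs).trans_le h1
  -- The bound on the energy change, divided by `t * ν(A)`; its limit is negative by `hlt`, so some
  -- small `t` contradicts minimality.
  have htend : Tendsto (fun t : ℝ => L + (deriv f (s' + t / volume.real B * ν.real A)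
      - deriv f ((1 - t) * s))) (𝓝[>] 0) (𝓝 (L + (deriv f s' - deriv f s))) := by
    refine Tendsto.mono_left ?_ nhdsWithin_le_nhds
    have h1 : ContinuousAt (deriv f) s' := hf.continuousOn_deriv.continuousAt (Ioi_mem_nhds hs')
    have h2 : ContinuousAt (deriv f) s := hf.continuousOn_deriv.continuousAt (Ioi_mem_nhds hs)
    have h3 : Tendsto (fun t : ℝ => s' + t / volume.real B * ν.real A) (𝓝 0) (𝓝 s') := by
      have : Continuous fun t : ℝ => s' + t / volume.real B * ν.real A := by fun_prop
      simpa using this.tendsto 0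
    have h4 : Tendsto (fun t : ℝ => (1 - t) * s) (𝓝 0) (𝓝 s) := by
      have : Continuous fun t : ℝ => (1 - t) * s := by fun_prop
      simpa using this.tendsto 0
    exact ((h1.tendsto.comp h3).sub (h2.tendsto.comp h4)).const_add L
  obtain ⟨t, ht, ht0, ht1⟩ := ((htend.eventually_lt_const (show _ < (0 : ℝ) by linarith)).and
    (Ioo_mem_nhdsGT (zero_lt_one (α := ℝ)))).exists
  have hcong := congestion_transfer_le hf hY hfin.1 hfin.2 hA hBm hAY hBY hAB hB0 hνA hs hsA
    hsB ht0 ht1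
  have hcost := transportCost_transfer_le hX hYc hc hμ hν.1 hA hBm (hBY.trans subset_closure)
    hB0 hBt ht0.le ht1.le (fun x hx y hy y' hy' => hL x hx y hy.1 y' hy')
  have hmin := hν.le_of_finite_congestion hfin
    (transfer_mem_probOn hν.1 hA hBm (hBY.trans subset_closure) hB0 hBt ht0.le ht1.le)
    ⟨transfer_absolutelyContinuous hfin.1 hBY t, hcong.1⟩
  have hneg := mul_neg_of_pos_of_neg (mul_pos ht0 hνA) ht
  linarith [hcong.2]

end Minimizer

end CongestionOT

namespace CongestionOT

/-! ### Lipschitz regularity of `f'` of the density, and comparison with `K`. -/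

section Regularity

variable {m n : ℕ} {X : Set (E m)} {Y : Set (E n)} {c : E m → E n → ℝ} {f : ℝ → ℝ}
  {μ : Measure (E m)} {ν : Measure (E n)}

lemma lipConst_nonneg (X : Set (E m)) (Y : Set (E n)) (c : E m → E n → ℝ) :
    0 ≤ lipConst X Y c := by
  refine Real.sSup_nonneg ?_
  rintro q ⟨x, -, y₀, -, y₁, -, -, rfl⟩
  positivity

lemma cost_le_add_lipConst (hcLip : BddAbove (lipQuotients X Y c)) {x : E m}
    (hx : x ∈ closure X) {y y' : E n} (hy : y ∈ closure Y) (hy' : y' ∈ closure Y) :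
    c x y' ≤ c x y + lipConst X Y c * ‖y - y'‖ := by
  rcases eq_or_ne y y' with rfl | h
  · simp
  · have h1 : |c x y - c x y'| / ‖y - y'‖ ≤ lipConst X Y c :=
      le_csSup hcLip ⟨x, hx, y, hy, y', hy', h, rfl⟩
    rw [div_le_iff₀ (norm_pos_iff.2 (sub_ne_zero.2 h))] at h1
    linarith [neg_abs_le (c x y - c x y')]

/-- Almost every point of a measurable set has all its neighbourhoods meet the set in positive
measure. -/
lemma ae_forall_nhds_measure_inter_ne_zero {S : Set (E n)} (hS : MeasurableSet S) :
    ∀ᵐ y, y ∈ S → ∀ U ∈ 𝓝 y, volume (U ∩ S) ≠ 0 := by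
  rw [← ae_restrict_iff' hS]
  filter_upwards [(Measure.support_mem_ae : (volume.restrict S).support ∈ ae _)] with y hy U hU
  have := (Measure.mem_support_iff_forall y).1 hy U hU
  rw [Measure.restrict_apply' hS] at this
  exact this.ne'

/-- Off a null set, `f'(ν̄)` does not increase by more than `M_c` times the distance; the density
may vanish here, so the values of `f'` are taken below and above the densities. -/
lemma IsMinimizer.exists_null_deriv_le (hν : IsMinimizer Y c f μ ν) (hX : IsCompact (closure X))
    (hYc : IsCompact (closure Y)) (hYm : MeasurableSet Y) (hY0 : volume Y ≠ 0)
    (hc : ContinuousOn (fun p : E m × E n => c p.1 p.2) (closure X ×ˢ closure Y))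
    (hcLip : BddAbove (lipQuotients X Y c))
    (hf : IsCongestionFunction f) (hμ : μ ∈ probOn (closure X)) :
    ∃ G : Set (E n), (∀ᵐ y, y ∈ G) ∧ ∀ y₀ ∈ G ∩ Y, ∀ y₁ ∈ G ∩ Y, ∀ s s' : ℝ, 0 < s →
      s < density ν y₁ → density ν y₀ < s' →
        deriv f s ≤ deriv f s' + lipConst X Y c * ‖y₁ - y₀‖ := by
  have hmA : ∀ q : ℚ, MeasurableSet (Y ∩ {y | (q : ℝ) < density ν y}) := fun q =>
    hYm.inter (measurableSet_lt measurable_const (measurable_density ν))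
  have hmB : ∀ q : ℚ, MeasurableSet (Y ∩ {y | density ν y < (q : ℝ)}) := fun q =>
    hYm.inter (measurableSet_lt (measurable_density ν) measurable_const)
  -- Rational levels keep the exceptional set a countable union of null sets.
  refine ⟨{y | ∀ q : ℚ,
    (y ∈ Y ∩ {y | (q : ℝ) < density ν y} →
      ∀ U ∈ 𝓝 y, volume (U ∩ (Y ∩ {y | (q : ℝ) < density ν y})) ≠ 0) ∧
    (y ∈ Y ∩ {y | density ν y < (q : ℝ)} →
      ∀ U ∈ 𝓝 y, volume (U ∩ (Y ∩ {y | density ν y < (q : ℝ)})) ≠ 0)}, ?_, ?_⟩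
  · refine ae_all_iff.2 fun q => ?_
    filter_upwards [ae_forall_nhds_measure_inter_ne_zero (hmA q),
      ae_forall_nhds_measure_inter_ne_zero (hmB q)] with y h1 h2 using ⟨h1, h2⟩
  · rintro y₀ ⟨hy₀, hy₀Y⟩ y₁ ⟨hy₁, hy₁Y⟩ s s' hs hs1 hs0
    by_contra! hlt
    -- Replacing `s` and `s'` by rationals nearer the densities only widens the assumed violation.
    -- The strict room left admits an `L` that bounds the cost on whole neighbourhoods of the two
    -- points.
    obtain ⟨q, hsq, hq1⟩ := exists_rat_btwn hs1
    obtain ⟨q', hq0, hqs'⟩ := exists_rat_btwn hs0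
    have hq'pos : (0 : ℝ) < q' := (density_nonneg ν y₀).trans_lt hq0
    have hqpos : (0 : ℝ) < q := hs.trans hsq
    have hdq := hf.strictMonoOn_deriv hs hqpos hsq
    have hdq' := hf.strictMonoOn_deriv hq'pos (hq'pos.trans hqs') hqs'
    obtain ⟨L, hL1, hL2⟩ := exists_between
      (show lipConst X Y c * ‖y₁ - y₀‖ < deriv f q - deriv f q' by linarith)
    have hnhds : {p : E n × E n | lipConst X Y c * ‖p.1 - p.2‖ < L} ∈ 𝓝 (y₁, y₀) :=
      (isOpen_lt (by fun_prop) continuous_const).mem_nhds hL1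
    obtain ⟨U, hU, V, hV, hUV⟩ := mem_nhds_prod_iff.1 hnhds
    obtain ⟨U', hU'U, hU'o, hyU'⟩ := mem_nhds_iff.1 hU
    obtain ⟨V', hV'V, hV'o, hyV'⟩ := mem_nhds_iff.1 hV
    have hnn : 0 ≤ lipConst X Y c * ‖y₁ - y₀‖ :=
      mul_nonneg (lipConst_nonneg X Y c) (norm_nonneg _)
    have hcost : ∀ x ∈ closure X, ∀ y ∈ U' ∩ (Y ∩ {y | (q : ℝ) < density ν y}),
        ∀ y' ∈ V' ∩ (Y ∩ {y | density ν y < (q' : ℝ)}), c x y' ≤ c x y + L := by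
      intro x hx y hy y' hy'
      have hp : (y, y') ∈ U ×ˢ V := mk_mem_prod (hU'U hy.1) (hV'V hy'.1)
      have h1 := hUV hp
      rw [mem_ofPred_eq] at h1
      have h2 := cost_le_add_lipConst hcLip hx (subset_closure hy.2.1) (subset_closure hy'.2.1)
      linarith
    rcases hν.null_or_null (s := q) (s' := q') (L := L) hX hYc hYm hY0 hc hf hμ
      (hU'o.measurableSet.inter (hmA q)) (hV'o.measurableSet.inter (hmB q'))
      (fun y hy => hy.2.1) (fun y hy => hy.2.1) hqpos hq'pos (hnn.trans hL1.le)
      (fun y hy => hy.2.2) (fun y hy => hy.2.2) hcost (by linarith) with h | h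
    · exact (hy₁ q).1 ⟨hy₁Y, hq1⟩ U' (hU'o.mem_nhds hyU') h
    · exact (hy₀ q').2 ⟨hy₀Y, hq0⟩ V' (hV'o.mem_nhds hyV') h

lemma IsMinimizer.setIntegral_density_eq_one (hν : IsMinimizer Y c f μ ν)
    (hac : ν ≪ volume.restrict Y) (hYm : MeasurableSet Y) : ∫ y in Y, density ν y = 1 := by
  have := hν.1.1
  rw [setIntegral_density hac, measureReal_def, (prob_compl_eq_zero_iff hYm).1
    (hac (by simp [Measure.restrict_apply' hYm])), ENNReal.toReal_one]

/-- The density of a minimizer is `(f')⁻¹(g)` for a function `g` with Lipschitz constant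
`M_c`. -/
lemma IsMinimizer.exists_lipschitz (hν : IsMinimizer Y c f μ ν) (hX : IsCompact (closure X))
    (hYc : IsCompact (closure Y)) (hYm : MeasurableSet Y) (hY0 : volume Y ≠ 0)
    (hc : ContinuousOn (fun p : E m × E n => c p.1 p.2) (closure X ×ˢ closure Y))
    (hcLip : BddAbove (lipQuotients X Y c))
    (hf : IsCongestionFunction f) (hμ : μ ∈ probOn (closure X)) :
    ∃ g : E n → ℝ, LipschitzWith (lipConst X Y c).toNNReal g ∧
      ∀ᵐ y ∂(volume.restrict Y), density ν y = derivInv f (g y) := by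
  have hY : volume Y ≠ ⊤ := measure_ne_top_of_subset subset_closure hYc.measure_lt_top.ne
  have hac := (hν.finite_congestion hYm hY hY0).1
  obtain ⟨G, hG, hle⟩ := hν.exists_null_deriv_le hX hYc hYm hY0 hc hcLip hf hμ
  obtain ⟨y₁, hy₁, hpos₁⟩ : ∃ y₁ ∈ G ∩ Y, 0 < density ν y₁ := by
    by_contra! h
    have h0 : ∫ y in Y, density ν y = 0 := by
      refine integral_eq_zero_of_ae ?_
      filter_upwards [ae_restrict_of_ae hG, ae_restrict_mem hYm] with y h1 h2
      exact le_antisymm (h y ⟨h1, h2⟩) (density_nonneg ν y)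
    rw [hν.setIntegral_density_eq_one hac hYm] at h0
    exact one_ne_zero h0
  have hpos : ∀ y ∈ G ∩ Y, 0 < density ν y := by
    intro y hy
    refine (density_nonneg ν y).lt_of_ne' fun h0 => ?_
    -- At a zero of the density every `s' > 0` is admissible, and `f'(s')` can be taken below any
    -- bound that `y₁` imposes.
    obtain ⟨s', hs', hlt⟩ := hf.exists_deriv_lt
      (deriv f (density ν y₁ / 2) - lipConst X Y c * ‖y₁ - y‖)
    have := hle y hy y₁ hy₁ (density ν y₁ / 2) s' (by linarith) (by linarith) (by rwa [h0])
    linarith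
  have hlip : ∀ y₀ ∈ G ∩ Y, ∀ y₁ ∈ G ∩ Y,
      deriv f (density ν y₁) ≤ deriv f (density ν y₀) + lipConst X Y c * ‖y₁ - y₀‖ := by
    intro y₀ hy₀ y₁ hy₁
    refine le_of_forall_pos_le_add fun ε hε => ?_
    -- The inequality `hle` wants levels strictly below and above the densities; shifting `f'` by `ε
    -- / 2` each way produces them.
    have h1 : derivInv f (deriv f (density ν y₁) - ε / 2) < density ν y₁ := by
      conv_rhs => rw [← hf.derivInv_deriv (hpos y₁ hy₁)]
      exact hf.strictMono_derivInv (by linarith)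
    have h0 : density ν y₀ < derivInv f (deriv f (density ν y₀) + ε / 2) := by
      conv_lhs => rw [← hf.derivInv_deriv (hpos y₀ hy₀)]
      exact hf.strictMono_derivInv (by linarith)
    have := hle y₀ hy₀ y₁ hy₁ _ _ (hf.derivInv_pos _) h1 h0
    rw [hf.deriv_derivInv, hf.deriv_derivInv] at this
    linarith
  have hon : LipschitzOnWith (lipConst X Y c).toNNReal (fun y => deriv f (density ν y))
      (G ∩ Y) := by
    refine LipschitzOnWith.of_dist_le_mul fun y hy y' hy' => ?_
    rw [Real.coe_toNNReal _ (lipConst_nonneg X Y c), Real.dist_eq, dist_eq_norm, abs_le]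
    have h1 := hlip y hy y' hy'
    rw [norm_sub_rev] at h1
    exact ⟨by linarith, by linarith [hlip y' hy' y hy]⟩
  -- The extension gives meaning to `g 0`, since the origin is known only to lie in the closure of
  -- `Y`.
  obtain ⟨g, hg, heq⟩ := hon.extend_real
  refine ⟨g, hg, ?_⟩
  filter_upwards [ae_restrict_of_ae hG, ae_restrict_mem hYm] with y h1 h2
  have h := heq ⟨h1, h2⟩
  beta_reduce at h
  rw [← h, hf.derivInv_deriv (hpos y ⟨h1, h2⟩)]

/-- If `g` has Lipschitz constant `M` and `(f')⁻¹(g)` has mass one, then `g(0)` lies between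
`K_{-M|y|}(1)` and `K_{M|y|}(1)`. -/
lemma mem_Icc_K_one_of_lipschitz {M : ℝ} (hM : 0 ≤ M) {g : E n → ℝ}
    (hg : ∀ y, |g y - g 0| ≤ M * ‖y‖) (hgc : Continuous g) (hf : IsCongestionFunction f)
    (hYb : Bornology.IsBounded Y) (hYm : MeasurableSet Y) (hY0 : volume Y ≠ 0)
    (hmass : ∫ y in Y, derivInv f (g y) = 1) :
    g 0 ∈ Icc (K Y f (fun z => -(M * ‖z‖)) 1) (K Y f (fun z => M * ‖z‖) 1) := by
  have hY : volume Y ≠ ⊤ := hYb.measure_lt_top.ne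
  obtain ⟨R, hR⟩ := hYb.exists_norm_le
  have hMR : ∀ y ∈ Y, M * ‖y‖ ≤ M * R := fun y hy => mul_le_mul_of_nonneg_left (hR y hy) hM
  have hMn : ∀ y : E n, 0 ≤ M * ‖y‖ := fun y => mul_nonneg hM (norm_nonneg y)
  have hl : ∀ y, g 0 - M * ‖y‖ ≤ g y := fun y => by linarith [neg_le_of_abs_le (hg y)]
  have hu : ∀ y, g y ≤ g 0 + M * ‖y‖ := fun y => by linarith [le_of_abs_le (hg y)]
  have hcmp : ∀ w w' : E n → ℝ, Continuous w → Continuous w' →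
      (∀ y ∈ Y, w' y ≤ g 0 + 3 * (M * R)) → (∀ y ∈ Y, w y ≤ w' y) →
      ∫ y in Y, derivInv f (w y) ≤ ∫ y in Y, derivInv f (w' y) := fun w w' hw hw' hb hle =>
    setIntegral_mono_on
      (integrableOn_derivInv_comp hf hYm hY hw fun y hy => (hle y hy).trans (hb y hy))
      (integrableOn_derivInv_comp hf hYm hY hw' hb) hYm
      fun y hy => hf.strictMono_derivInv.monotone (hle y hy)
  constructor
  -- The upper endpoint carries the content: `g ≤ g 0 + M‖y‖` gives mass at least one at `z = g 0`.
  -- The endpoint `g 0 - 2MR` only starts the intermediate value argument: on `Y`, `g 0 - 2MR + M‖y‖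
  -- ≤ g 0 - M‖y‖ ≤ g`.
  · refine (K_one_mem_Icc (R := M * R) (a := g 0 - 2 * (M * R)) (b := g 0) hf hYm hY hY0
      (by fun_prop) ?_ ?_ ?_).2
    · intro y hy
      rw [abs_neg, abs_of_nonneg (hMn y)]
      exact hMR y hy
    · rw [← hmass]
      refine hcmp _ _ (by fun_prop) hgc (fun y hy => ?_) fun y hy => ?_
      · linarith [hu y, hMR y hy, hMn y]
      · linarith [hl y, hMR y hy]
    · rw [← hmass]
      refine hcmp _ _ hgc (by fun_prop) (fun y hy => ?_) fun y hy => ?_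
      · linarith [hMR y hy, hMn y]
      · linarith [hu y]
  -- The mirror image: `g 0 - M‖y‖ ≤ g` gives mass at most one at `z = g 0`, and `g 0 + 2MR` is the
  -- auxiliary endpoint.
  · refine (K_one_mem_Icc (R := M * R) (a := g 0) (b := g 0 + 2 * (M * R)) hf hYm hY hY0
      (by fun_prop) ?_ ?_ ?_).1
    · intro y hy
      rw [abs_of_nonneg (hMn y)]
      exact hMR y hy
    · rw [← hmass]
      refine hcmp _ _ (by fun_prop) hgc (fun y hy => ?_) fun y hy => ?_
      · linarith [hu y, hMR y hy, hMn y]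
      · linarith [hl y]
    · rw [← hmass]
      refine hcmp _ _ hgc (by fun_prop) (fun y hy => ?_) fun y hy => ?_
      · linarith [hMR y hy, hMn y]
      · linarith [hu y, hMR y hy]

end Regularity

end CongestionOT

theorem mainTheorem4 {m n : ℕ}
    (X : Set (CongestionOT.E m)) (Y : Set (CongestionOT.E n))
    (hXo : IsOpen X) (hXb : Bornology.IsBounded X)
    (hYo : IsOpen Y) (hYb : Bornology.IsBounded Y)
    (h0 : (0 : CongestionOT.E n) ∈ closure Y)
    (c : CongestionOT.E m → CongestionOT.E n → ℝ)
    (hc : ContinuousOn (fun p : CongestionOT.E m × CongestionOT.E n => c p.1 p.2)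
      (closure X ×ˢ closure Y))
    (hcLip : BddAbove (CongestionOT.lipQuotients X Y c))
    (f : ℝ → ℝ) (hf : CongestionOT.IsCongestionFunction f)
    (μ : Measure (CongestionOT.E m)) (hμ : μ ∈ CongestionOT.probOn (closure X))
    (ν : Measure (CongestionOT.E n)) (hν : CongestionOT.IsMinimizer Y c f μ ν) :
    ν ≪ volume.restrict Y ∧
    ∀ᵐ y ∂(volume.restrict Y),
      CongestionOT.derivInv f
          (CongestionOT.K Y f (fun z => -(CongestionOT.lipConst X Y c * ‖z‖)) 1
            - CongestionOT.lipConst X Y c * ‖y‖)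
        ≤ CongestionOT.density ν y ∧
      CongestionOT.density ν y
        ≤ CongestionOT.derivInv f
          (CongestionOT.K Y f (fun z => CongestionOT.lipConst X Y c * ‖z‖) 1
            + CongestionOT.lipConst X Y c * ‖y‖) := by
  have hX : IsCompact (closure X) := hXb.isCompact_closure
  have hYc : IsCompact (closure Y) := hYb.isCompact_closure
  have hYm : MeasurableSet Y := hYo.measurableSet
  have hY : volume Y ≠ ⊤ := hYb.measure_lt_top.ne
  have hY0 : volume Y ≠ 0 := (hYo.measure_pos volume (closure_nonempty_iff.1 ⟨0, h0⟩)).ne'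
  have hac := (hν.finite_congestion hYm hY hY0).1
  refine ⟨hac, ?_⟩
  obtain ⟨g, hg, hdens⟩ := hν.exists_lipschitz hX hYc hYm hY0 hc hcLip hf hμ
  have hM := CongestionOT.lipConst_nonneg X Y c
  have hg0 : ∀ y, |g y - g 0| ≤ CongestionOT.lipConst X Y c * ‖y‖ := by
    intro y
    have h := hg.dist_le_mul y 0
    rwa [Real.coe_toNNReal _ hM, Real.dist_eq, dist_zero_right] at h
  have hmass : ∫ y in Y, CongestionOT.derivInv f (g y) = 1 := by
    rw [← integral_congr_ae hdens, hν.setIntegral_density_eq_one hac hYm]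
  have hK := CongestionOT.mem_Icc_K_one_of_lipschitz hM hg0 hg.continuous hf hYb hYm hY0 hmass
  filter_upwards [hdens] with y hy
  have hmono := hf.strictMono_derivInv.monotone
  rw [hy]
  -- The Lipschitz cone at the origin appears twice: in the bounds for `g 0` and again in passing
  -- from `g 0` to `g y`.
  exact ⟨hmono (by linarith [hK.1, neg_le_of_abs_le (hg0 y)]),
    hmono (by linarith [hK.2, le_of_abs_le (hg0 y)])⟩
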